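/- A \emph{$d$-domain} is an open subset of $\mathbb{R}^d$. A smooth map $\pi : E \to X$ of diffeological spaces is a \emph{diffeological étale map} if for every plot $P : U \to X$ ($U$ a domain) the pullback $P^*\pi : \{(r,\xi)\in U\times E \mid P(r)=\pi(\xi)\} \to U$, $(r,\xi)\mapsto r$, is étale, i.e. around every point of its source it restricts to a diffeomorphism between D-open subsets. A diffeological space is a \emph{diffeological étale $d$-manifold} if it is covered by the images of diffeological étale maps defined on $d$-domains. The \emph{internal tangent space} $T_xX$ is the colimit of the vector spaces $T_0\,\mathrm{dom}(P)$ over the category of germs of plots $P$ in $X$ centered at $x$ (that is, $0\in\mathrm{dom}(P)$ and $P(0)=x$), a morphism $Q\to P$ being the germ at $0$ of a smooth map $F$ with $F(0)=0$ and $Q=P\circ F$ near $0$, which acts by $dF_0$. A smooth map $f : X\to Y$ induces linear maps $df_x : T_xX\to T_{f(x)}Y$, determined by $df_x\circ dP_0=d(f\circ P)_0$; it has \emph{constant internal rank} $k$ if $\operatorname{rank} df_x=k$ for every $x\in X$. \textbf{Theorem (rank theorem for diffeological étale manifolds).} Let $\mathcal{M}$ and $\mathcal{N}$ be diffeological étale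 manifolds of dimensions $m$ and $n$, respectively, and let $f:\mathcal{M}\to\mathcal{N}$ be a smooth map with constant internal rank $k$. Then for each $x\in\mathcal{M}$ we have $k\le m$ and $k\le n$, and there exist an $m$-domain $U$, an $n$-domain $V$, and diffeological étale maps $\varphi:U\to\mathcal{M}$ with $x\in\varphi(U)$ and $\psi:V\to\mathcal{N}$ with $f(x)\in\psi(V)$, such that $\widehat F(U)\subseteq V$ and $f\circ\varphi=\psi\circ\widehat F|_U$, where $\widehat F:\mathbb{R}^m\to\mathbb{R}^n$ is given by $$\widehat F(x_1,\dots,x_k,x_{k+1},\dots,x_m)=(x_1,\dots,x_k,0,\dots,0).$$ -/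

import Mathlib

open scoped ContDiff Topology

noncomputable section

namespace EtaleDiffeology

open Diffeology TopologicalSpace

/-- Euclidean space `ℝⁿ`; an `n`-domain is a term of `Opens (Eucl n)`. -/
abbrev Eucl (n : ℕ) : Type := EuclideanSpace ℝ (Fin n)

/-! ### Subspaces, products, pullbacks -/

/-- The subspace diffeology: a map into the subtype is a plot iff it is a plot in `X`. In
particular every `n`-domain `U` is a diffeological space, and a parametrization `P : U → X` is a
plot exactly when `DSmooth P`. -/
instance subtypeDiffeology {X : Type*} [DiffeologicalSpace X] (s : X → Prop) :
    DiffeologicalSpace (Subtype s) where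
  plots n := {p | IsPlot (fun r => (p r : X))}
  constant_plots x := DiffeologicalSpace.constant_plots (x : X)
  plot_reparam hp hf := DiffeologicalSpace.plot_reparam hp hf
  locality hp := DiffeologicalSpace.locality fun x =>
    let ⟨u, hu, hxu, h⟩ := hp x
    ⟨u, hu, hxu, fun hfu hf => h hfu hf⟩

/-- The product diffeology. -/
instance prodDiffeology {X Y : Type*} [DiffeologicalSpace X] [DiffeologicalSpace Y] :
    DiffeologicalSpace (X × Y) where
  plots n := {p | IsPlot (fun r => (p r).1) ∧ IsPlot (fun r => (p r).2)}
  constant_plots x :=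
    ⟨DiffeologicalSpace.constant_plots x.1, DiffeologicalSpace.constant_plots x.2⟩
  plot_reparam hp hf :=
    ⟨DiffeologicalSpace.plot_reparam hp.1 hf, DiffeologicalSpace.plot_reparam hp.2 hf⟩
  locality hp :=
    ⟨DiffeologicalSpace.locality fun x =>
      let ⟨u, hu, hxu, h⟩ := hp x
      ⟨u, hu, hxu, fun hfu hf => (h hfu hf).1⟩,
     DiffeologicalSpace.locality fun x =>
      let ⟨u, hu, hxu, h⟩ := hp x
      ⟨u, hu, hxu, fun hfu hf => (h hfu hf).2⟩⟩

/-! ### Étale maps and diffeological étale maps -/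

/-- `f` is étale: around every point it restricts to a diffeomorphism between D-open subsets. -/
def IsEtale {X Y : Type*} [DiffeologicalSpace X] [DiffeologicalSpace Y] (f : X → Y) : Prop :=
  ∀ x₀ : X, ∃ (O : Set X) (O' : Set Y), IsOpen[dTopology] O ∧ IsOpen[dTopology] O' ∧
    x₀ ∈ O ∧ f x₀ ∈ O' ∧
    ∃ e : O ≃ O', DSmooth e ∧ DSmooth e.symm ∧ ∀ x : O, (e x : Y) = f x

/-- `π` is a diffeological étale map: it is smooth and its pullback `P^*π : P^*E → U` by every
plot `P : U → X` (defined on a domain `U`) is étale. -/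
def IsDiffEtale {E X : Type*} [DiffeologicalSpace E] [DiffeologicalSpace X] (π : E → X) : Prop :=
  DSmooth π ∧ ∀ (d : ℕ) (U : Opens (Eucl d)) (P : U → X), DSmooth P →
    IsEtale (Function.Pullback.fst : Function.Pullback P π → U)

/-- `M` is a diffeological étale `n`-manifold: it has an atlas, that is, a family of
diffeological étale maps defined on `n`-domains whose images cover `M`. -/
def IsEtaleManifold (n : ℕ) (M : Type*) [DiffeologicalSpace M] : Prop :=
  ∃ A : Set (Σ U : Opens (Eucl n), (U → M)),
    (∀ c ∈ A, IsDiffEtale c.2) ∧ ∀ x : M, ∃ c ∈ A, x ∈ Set.range c.2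

/-! ### Internal tangent spaces -/

/-- A plot in `X` centered at `x`: it is defined on a domain containing `0` and sends `0` to
`x`. -/
structure CenteredPlot (X : Type*) [DiffeologicalSpace X] (x : X) where
  dim : ℕ
  dom : Opens (Eucl dim)
  zero_mem : (0 : Eucl dim) ∈ dom
  toFun : dom → X
  smooth : DSmooth toFun
  map_zero : toFun ⟨0, zero_mem⟩ = x

/-- The composition of a smooth map with a centered plot. -/
def CenteredPlot.map {X Y : Type*} [DiffeologicalSpace X] [DiffeologicalSpace Y] {f : X → Y}
    (hf : DSmooth f) {x : X} (P : CenteredPlot X x) : CenteredPlot Y (f x) where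
  dim := P.dim
  dom := P.dom
  zero_mem := P.zero_mem
  toFun := f ∘ P.toFun
  smooth := hf.comp P.smooth
  map_zero := congrArg f P.map_zero

/-- `F` represents a morphism `Q ⟶ P` of germs of centered plots: near `0` it is smooth, takes
values in the domain of `P`, and satisfies `Q = P ∘ F`; moreover `F 0 = 0`. -/
def IsGermHom {X : Type*} [DiffeologicalSpace X] {x : X} (Q P : CenteredPlot X x)
    (F : Eucl Q.dim → Eucl P.dim) : Prop :=
  F 0 = 0 ∧ ∃ W : Opens (Eucl Q.dim), (0 : Eucl Q.dim) ∈ W ∧ ContDiffOn ℝ ∞ F W ∧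
    ∀ r ∈ W, ∃ (hQ : r ∈ Q.dom) (hP : F r ∈ P.dom), Q.toFun ⟨r, hQ⟩ = P.toFun ⟨F r, hP⟩

open Classical in
/-- The relations `ι_P (dF₀ v) = ι_Q v`, for all morphisms `F : Q ⟶ P`, in the direct sum of the
tangent spaces `T₀ (dom P) = ℝ^(dim P)` over all plots centered at `x`. -/
def tangentRelations (X : Type*) [DiffeologicalSpace X] (x : X) :
    Submodule ℝ (DirectSum (CenteredPlot X x) fun P => Eucl P.dim) :=
  Submodule.span ℝ {w | ∃ (Q P : CenteredPlot X x) (F : Eucl Q.dim → Eucl P.dim) (v : Eucl Q.dim),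
    IsGermHom Q P F ∧
    w = DirectSum.lof ℝ (CenteredPlot X x) (fun P => Eucl P.dim) P (fderiv ℝ F 0 v) -
        DirectSum.lof ℝ (CenteredPlot X x) (fun P => Eucl P.dim) Q v}

/-- The internal tangent space `T_x X`: the colimit of the functor `T₀` from the category of germs
of plots centered at `x` to real vector spaces, realized as the quotient of the direct sum by the
relations given by the morphisms. -/
abbrev InternalTangentSpace (X : Type*) [DiffeologicalSpace X] (x : X) : Type _ :=
  (DirectSum (CenteredPlot X x) fun P => Eucl P.dim) ⧸ tangentRelations X x

open Classical in
/-- The structure map `dP₀ : T₀ (dom P) → T_x X` of the colimit. -/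
def plotDiff {X : Type*} [DiffeologicalSpace X] {x : X} (P : CenteredPlot X x) :
    Eucl P.dim →ₗ[ℝ] InternalTangentSpace X x :=
  (tangentRelations X x).mkQ ∘ₗ DirectSum.lof ℝ (CenteredPlot X x) (fun P => Eucl P.dim) P

theorem plotDiff_fderiv {X : Type*} [DiffeologicalSpace X] {x : X} {Q P : CenteredPlot X x}
    {F : Eucl Q.dim → Eucl P.dim} (hF : IsGermHom Q P F) (v : Eucl Q.dim) :
    plotDiff P (fderiv ℝ F 0 v) = plotDiff Q v :=
  (Submodule.Quotient.eq _).2 (Submodule.subset_span ⟨Q, P, F, v, hF, rfl⟩)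

open Classical in
/-- The map out of the colimit `T_x X` induced by a cocone. -/
def tangentDesc {X : Type*} [DiffeologicalSpace X] {x : X} {V : Type*} [AddCommGroup V]
    [Module ℝ V] (c : ∀ P : CenteredPlot X x, Eucl P.dim →ₗ[ℝ] V)
    (hc : ∀ (Q P : CenteredPlot X x) (F : Eucl Q.dim → Eucl P.dim), IsGermHom Q P F →
      ∀ v, c P (fderiv ℝ F 0 v) = c Q v) :
    InternalTangentSpace X x →ₗ[ℝ] V :=
  (tangentRelations X x).liftQ (DirectSum.toModule ℝ (CenteredPlot X x) V c) <| by
    refine Submodule.span_le.2 ?_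
    rintro _ ⟨Q, P, F, v, hF, rfl⟩
    simp [DirectSum.toModule_lof, hc Q P F hF v]

theorem tangentDesc_plotDiff {X : Type*} [DiffeologicalSpace X] {x : X} {V : Type*}
    [AddCommGroup V] [Module ℝ V] (c : ∀ P : CenteredPlot X x, Eucl P.dim →ₗ[ℝ] V)
    (hc : ∀ (Q P : CenteredPlot X x) (F : Eucl Q.dim → Eucl P.dim), IsGermHom Q P F →
      ∀ v, c P (fderiv ℝ F 0 v) = c Q v) (P : CenteredPlot X x) (v : Eucl P.dim) :
    tangentDesc c hc (plotDiff P v) = c P v := by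
  classical
  exact DirectSum.toModule_lof ℝ (φ := c) P v

theorem tangent_hom_ext {X : Type*} [DiffeologicalSpace X] {x : X} {V : Type*}
    [AddCommGroup V] [Module ℝ V] {a b : InternalTangentSpace X x →ₗ[ℝ] V}
    (h : ∀ (P : CenteredPlot X x) (v : Eucl P.dim), a (plotDiff P v) = b (plotDiff P v)) :
    a = b := by
  classical
  refine Submodule.linearMap_qext _ (DirectSum.linearMap_ext ℝ fun P => LinearMap.ext fun v => ?_)
  exact h P v

theorem IsGermHom.map {X Y : Type*} [DiffeologicalSpace X] [DiffeologicalSpace Y] {f : X → Y}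
    (hf : DSmooth f) {x : X} {Q P : CenteredPlot X x} {F : Eucl Q.dim → Eucl P.dim}
    (h : IsGermHom Q P F) : IsGermHom (Q.map hf) (P.map hf) F := by
  obtain ⟨h0, W, hW, hF, hr⟩ := h
  refine ⟨h0, W, hW, hF, fun r hrW => ?_⟩
  obtain ⟨hQ, hP, e⟩ := hr r hrW
  exact ⟨hQ, hP, congrArg f e⟩

/-- The internal tangent map `df_x : T_x X → T_{f(x)} Y`, the unique linear map with
`df_x ∘ dP₀ = d(f ∘ P)₀` for all plots `P` centered at `x`. -/
def tangentMap {X Y : Type*} [DiffeologicalSpace X] [DiffeologicalSpace Y] {f : X → Y}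
    (hf : DSmooth f) (x : X) :
    InternalTangentSpace X x →ₗ[ℝ] InternalTangentSpace Y (f x) :=
  tangentDesc (fun P => plotDiff (P.map hf)) fun _ _ _ hF v => plotDiff_fderiv (hF.map hf) v

theorem tangentMap_plotDiff {X Y : Type*} [DiffeologicalSpace X] [DiffeologicalSpace Y]
    {f : X → Y} (hf : DSmooth f) {x : X} (P : CenteredPlot X x) (v : Eucl P.dim) :
    tangentMap hf x (plotDiff P v) = plotDiff (P.map hf) v :=
  tangentDesc_plotDiff _ _ P v

/-- The smooth map `f` has constant internal rank `k`. -/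
def HasConstantInternalRank {X Y : Type*} [DiffeologicalSpace X] [DiffeologicalSpace Y]
    {f : X → Y} (hf : DSmooth f) (k : ℕ) : Prop :=
  ∀ x : X, (tangentMap hf x).rank = (k : Cardinal)

/-! ### The normal form -/

/-- The map `(x₁, …, x_k, x_{k+1}, …, x_m) ↦ (x₁, …, x_k, 0, …, 0)` from `ℝᵐ` to `ℝⁿ`. -/
def rankNormalForm (m n k : ℕ) (hkm : k ≤ m) (x : Eucl m) : Eucl n :=
  WithLp.toLp 2 fun i : Fin n => if h : i.1 < k then x ⟨i.1, h.trans_le hkm⟩ else 0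

end EtaleDiffeology

end

namespace EtaleDiffeology

open Diffeology TopologicalSpace

/-! ### Smooth maps on domains -/

/-! For a smooth map `π` from a domain, being diffeological étale amounts to a lifting property:
every plot lifts locally along `π` through any prescribed point (`HasLocalLifts`), and smooth local
lifts with a common value at a point agree near it (`HasUniqueLocalLifts`). Everything is deduced
from this.

First, at `x = π u` the recentered plot `r ↦ π (u + r)` is terminal in the category of germs of
plots centered at `x`: a morphism into it is exactly a germ of a lift. The colimit `T_x M` is
therefore `ℝᵐ`, via `chartDiff`.

Second, lifting `f ∘ φ` along an étale chart `ψ` of the target gives an ordinary smooth map `F` with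
`f ∘ φ = ψ ∘ F`. By the first point the rank of `dF_u` is the internal rank of `f` at `φ u`
(`finrank_range_fderiv_eq`), so `F` has constant rank `k`.

Third, the classical constant rank theorem (`exists_constantRank_coord`) yields coordinates `α`, `β`
in which `F` is the normal form. Lifting properties survive such changes of coordinates, so `φ ∘
α⁻¹` and `ψ ∘ β⁻¹` are again étale (`IsDiffEtale.comp_symm`). -/

theorem exists_smooth_chart_ball {d : ℕ} {O : Set (Eucl d)} (hO : IsOpen O) {r : Eucl d}
    (hr : r ∈ O) : ∃ u : OpenPartialHomeomorph (Eucl d) (Eucl d), u.source = Set.univ ∧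
      r ∈ u.target ∧ u.target ⊆ O ∧ ContDiff ℝ ∞ u ∧ ContDiffOn ℝ ∞ u.symm u.target := by
  obtain ⟨ε, hε, hb⟩ := Metric.isOpen_iff.mp hO r hr
  have ht := OpenPartialHomeomorph.univBall_target r hε
  exact ⟨OpenPartialHomeomorph.univBall r ε, OpenPartialHomeomorph.univBall_source r ε,
    ht ▸ Metric.mem_ball_self hε, ht ▸ hb, OpenPartialHomeomorph.contDiff_univBall,
    ht ▸ OpenPartialHomeomorph.contDiffOn_univBall_symm⟩

/-- Plots are defined on all of `ℝⁿ`, so smoothness on `O` can only be tested through global maps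
with values in `O`. A diffeomorphism of `ℝᵈ` onto a ball inside `O` is such a map, and composing
with its inverse recovers `L` on the ball. -/
theorem contDiffOn_of_comp_contDiff {d m : ℕ} {O : Set (Eucl d)} (hO : IsOpen O)
    {L : Eucl d → Eucl m}
    (h : ∀ g : Eucl d → Eucl d, ContDiff ℝ ∞ g → (∀ x, g x ∈ O) → ContDiff ℝ ∞ (L ∘ g)) :
    ContDiffOn ℝ ∞ L O := by
  intro r hr
  obtain ⟨u, hs, hrt, hto, hu, hu'⟩ := exists_smooth_chart_ball hO hr
  have h1 := h u hu fun x => hto (u.map_source (hs ▸ Set.mem_univ x))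
  have h2 : ContDiffOn ℝ ∞ ((L ∘ u) ∘ u.symm) u.target :=
    h1.comp_contDiffOn hu'
  have h3 : ContDiffOn ℝ ∞ L u.target :=
    h2.congr fun x hx => by simp [u.right_inv hx]
  exact (h3.contDiffAt (u.open_target.mem_nhds hrt)).contDiffWithinAt

theorem isPlot_opens_iff {d n : ℕ} {W : Opens (Eucl d)} {p : Eucl n → W} :
    IsPlot p ↔ ContDiff ℝ ∞ fun r => (p r : Eucl d) :=
  Iff.rfl

/-- Parametrizations of small balls by `ℝᵈ` are plots and open maps, so the D-topology of a domain
has no more open sets than the usual topology. -/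
theorem isOpen_dTopology_opens_iff {d : ℕ} {W : Opens (Eucl d)} {s : Set W} :
    IsOpen[dTopology] s ↔ IsOpen (Subtype.val '' s) := by
  rw [isOpen_iff_preimages_plots]
  constructor
  · intro h
    rw [isOpen_iff_forall_mem_open]
    rintro _ ⟨r, hr, rfl⟩
    obtain ⟨u, hs, hrt, hto, hu, -⟩ := exists_smooth_chart_ball W.isOpen r.2
    have hmem : ∀ x, u x ∈ W := fun x => hto (u.map_source (hs ▸ Set.mem_univ x))
    have hp := h d (fun x => ⟨u x, hmem x⟩) (isPlot_opens_iff.2 hu)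
    refine ⟨_, ?_, u.isOpen_image_of_subset_source hp (hs ▸ Set.subset_univ _), ?_⟩
    · rintro _ ⟨x, hx, rfl⟩
      exact ⟨_, hx, rfl⟩
    · refine ⟨u.symm r, ?_, u.right_inv hrt⟩
      have : (⟨u (u.symm r), hmem _⟩ : W) = r := Subtype.ext (u.right_inv hrt)
      simpa [this] using hr
  · intro h n p hp
    have hc : Continuous fun x => (p x : Eucl d) := (isPlot_opens_iff.1 hp).continuous
    have := h.preimage hc
    convert this using 1
    ext x
    simp

/-! ### Diffeological étale maps and lifts -/

/-- `L` lifts the plot `P : W → M` along `π : U → M` over the set `O`. -/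
def IsLiftOn {M : Type*} {m d : ℕ} {U : Opens (Eucl m)} (π : U → M) {W : Opens (Eucl d)}
    (P : W → M) (O : Set (Eucl d)) (L : Eucl d → Eucl m) : Prop :=
  ContDiffOn ℝ ∞ L O ∧
    ∀ r ∈ O, ∃ (hW : r ∈ W) (hU : L r ∈ U), P ⟨r, hW⟩ = π ⟨L r, hU⟩

/-- Plots lift locally along `π`, through every prescribed point. -/
def HasLocalLifts {M : Type*} [DiffeologicalSpace M] {m : ℕ} {U : Opens (Eucl m)}
    (π : U → M) : Prop :=
  ∀ (d : ℕ) (W : Opens (Eucl d)) (P : W → M), DSmooth P → ∀ (r : W) (u : U), P r = π u →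
    ∃ (O : Set (Eucl d)) (L : Eucl d → Eucl m), IsOpen O ∧ r.1 ∈ O ∧ L r = u ∧ IsLiftOn π P O L

/-- Smooth local lifts along `π` are determined near a point by their value there. -/
def HasUniqueLocalLifts {M : Type*} [DiffeologicalSpace M] {m : ℕ} {U : Opens (Eucl m)}
    (π : U → M) : Prop :=
  ∀ (d : ℕ) (O : Set (Eucl d)) (L L' : Eucl d → Eucl m), IsOpen O → ContDiffOn ℝ ∞ L O →
    ContDiffOn ℝ ∞ L' O →
    (∀ r ∈ O, ∃ (h : L r ∈ U) (h' : L' r ∈ U), π ⟨L r, h⟩ = π ⟨L' r, h'⟩) →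
    ∀ r ∈ O, L r = L' r → L =ᶠ[𝓝 r] L'

section

variable {M : Type*} [DiffeologicalSpace M] {m : ℕ} {U : Opens (Eucl m)} {π : U → M}

/-- A local inverse of the étale projection `P^*π → W` at `(r, u)` is a section; its second
component is the lift. -/
theorem IsDiffEtale.hasLocalLifts (hπ : IsDiffEtale π) : HasLocalLifts π := by
  classical
  intro d W P hP r u hru
  obtain ⟨S, S', -, hS', hS, hrS', e, -, he', hfst⟩ := hπ.2 d W P hP ⟨(r, u), hru⟩
  rw [isOpen_dTopology_opens_iff] at hS'
  let O : Set (Eucl d) := Subtype.val '' S'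
  have hO : ∀ x, x ∈ O → ∃ hW : x ∈ W, (⟨x, hW⟩ : W) ∈ S' := by
    rintro _ ⟨y, hy, rfl⟩
    exact ⟨y.2, hy⟩
  choose hW hS'' using hO
  let L : Eucl d → Eucl m := fun x =>
    if h : x ∈ O then (((e.symm ⟨⟨x, hW x h⟩, hS'' x h⟩).1.1.2 : U) : Eucl m) else 0
  have hL : ∀ x (h : x ∈ O), L x = (e.symm ⟨⟨x, hW x h⟩, hS'' x h⟩).1.1.2 := fun x h => dif_pos h
  have hr : r.1 ∈ O := ⟨r, hrS', rfl⟩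
  refine ⟨O, L, hS', hr, ?_, ?_, ?_⟩
  · rw [hL _ hr]
    have h1 : e ⟨⟨(r, u), hru⟩, hS⟩ = ⟨⟨r, hW _ hr⟩, hS'' _ hr⟩ := Subtype.ext (hfst _)
    rw [← h1, Equiv.symm_apply_apply]
  · refine contDiffOn_of_comp_contDiff hS' fun g hg hgO => ?_
    have hp : IsPlot (fun x => (⟨⟨g x, hW _ (hgO x)⟩, hS'' _ (hgO x)⟩ : S')) :=
      isPlot_opens_iff.2 hg
    have h2 : IsPlot (fun x =>
        ((e.symm ⟨⟨g x, hW _ (hgO x)⟩, hS'' _ (hgO x)⟩).1.1.2 : Eucl m)) := (he' _ _ hp).2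
    convert h2.contDiff using 1
    funext x
    exact hL _ (hgO x)
  · intro x hx
    have hmem : L x ∈ U := by rw [hL x hx]; exact ((e.symm _).1.1.2).2
    refine ⟨hW x hx, hmem, ?_⟩
    have h3 : (e.symm ⟨⟨x, hW x hx⟩, hS'' x hx⟩).1.1.1 = ⟨x, hW x hx⟩ := by
      have := hfst (e.symm ⟨⟨x, hW x hx⟩, hS'' x hx⟩)
      rw [Equiv.apply_symm_apply] at this
      exact this.symm
    have h4 := (e.symm ⟨⟨x, hW x hx⟩, hS'' x hx⟩).1.2
    rw [h3] at h4
    rw [h4]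
    exact congrArg π (Subtype.ext (hL x hx).symm)

theorem dSmooth_comp_contDiffOn (hπ : DSmooth π) {d : ℕ} {W : Opens (Eucl d)}
    {L : Eucl d → Eucl m} (hL : ContDiffOn ℝ ∞ L W) (hLU : ∀ r : W, L r ∈ U) :
    DSmooth fun r : W => π ⟨L r, hLU r⟩ := by
  intro n p hp
  refine hπ n (fun x => ⟨L (p x), hLU (p x)⟩) ?_
  exact isPlot_opens_iff.2 (hL.comp_contDiff (isPlot_opens_iff.1 hp) fun x => (p x).2)

/-- Two lifts are two smooth sections of the same pullback. If they meet over `r₀`, both stay near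
`r₀` in a D-open set on which the projection is injective, hence they coincide there. -/
theorem IsDiffEtale.hasUniqueLocalLifts (hπ : IsDiffEtale π) : HasUniqueLocalLifts π := by
  intro d O L L' hO hL hL' hLL' r₀ hr₀ heq
  choose hU hU' hE using hLL'
  let W : Opens (Eucl d) := ⟨O, hO⟩
  have hP : DSmooth fun r : W => π ⟨L r, hU r r.2⟩ := dSmooth_comp_contDiffOn hπ.1 hL _
  obtain ⟨S, S', hSo, -, hS, -, e, -, -, hfst⟩ :=
    hπ.2 d W _ hP ⟨(⟨r₀, hr₀⟩, ⟨L r₀, hU r₀ hr₀⟩), rfl⟩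
  obtain ⟨u, hs, hrt, hto, hu, -⟩ := exists_smooth_chart_ball hO hr₀
  have hmem : ∀ x, u x ∈ O := fun x => hto (u.map_source (hs ▸ Set.mem_univ x))
  have ho := isOpen_iff_preimages_plots.1 hSo d
    (fun x => ⟨(⟨u x, hmem x⟩, ⟨L (u x), hU _ (hmem x)⟩), rfl⟩)
    ⟨isPlot_opens_iff.2 hu, isPlot_opens_iff.2 (hL.comp_contDiff hu hmem)⟩
  have ho' := isOpen_iff_preimages_plots.1 hSo d
    (fun x => ⟨(⟨u x, hmem x⟩, ⟨L' (u x), hU' _ (hmem x)⟩), hE _ (hmem x)⟩)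
    ⟨isPlot_opens_iff.2 hu, isPlot_opens_iff.2 (hL'.comp_contDiff hu hmem)⟩
  have hi := u.isOpen_image_of_subset_source (ho.inter ho') (hs ▸ Set.subset_univ _)
  have hx₀ : u (u.symm r₀) = r₀ := u.right_inv hrt
  refine Filter.eventuallyEq_iff_exists_mem.2 ⟨_, hi.mem_nhds ⟨u.symm r₀, ⟨?_, ?_⟩, hx₀⟩, ?_⟩
  · simpa only [Set.mem_preimage, hx₀] using hS
  · simpa only [Set.mem_preimage, hx₀, ← heq] using hS
  · rintro _ ⟨x, ⟨h1, h2⟩, rfl⟩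
    have h3 := e.injective (a₁ := ⟨_, h1⟩) (a₂ := ⟨_, h2⟩)
      (Subtype.ext ((hfst ⟨_, h1⟩).trans (hfst ⟨_, h2⟩).symm))
    have h4 := congrArg (fun z : S => ((z.1.1.2 : U) : Eucl m)) h3
    exact h4

/-- Converse of the two preceding results. The graph of a local lift is a sheet on which the
projection has a smooth inverse; uniqueness of lifts is what makes this graph D-open in the
pullback. -/
theorem isDiffEtale_of_lifts (hπ : DSmooth π) (hex : HasLocalLifts π)
    (huniq : HasUniqueLocalLifts π) : IsDiffEtale π := by
  refine ⟨hπ, fun d W P hP z => ?_⟩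
  obtain ⟨O, L, hO, hr, hLr, hL, hlift⟩ := hex d W P hP z.1.1 z.1.2 z.2
  choose hW hU hPL using hlift
  let S : Set (Function.Pullback P π) := {z | z.1.1.1 ∈ O ∧ z.1.2.1 = L z.1.1.1}
  let S' : Set W := {r | r.1 ∈ O}
  let e : S ≃ S' :=
    { toFun := fun z => ⟨z.1.1.1, z.2.1⟩
      invFun := fun r => ⟨⟨(r.1, ⟨L r.1.1, hU _ r.2⟩), hPL _ r.2⟩, r.2, rfl⟩
      left_inv := fun z => by
        refine Subtype.ext (Subtype.ext (Prod.ext rfl (Subtype.ext z.2.2.symm)))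
      right_inv := fun r => rfl }
  refine ⟨S, S', ?_, ?_, ⟨hr, hLr.symm⟩, hr, e, ?_, ?_, fun _ => rfl⟩
  · rw [isOpen_iff_preimages_plots]
    intro n p hp
    have hp1 : ContDiff ℝ ∞ fun x => ((p x).1.1 : Eucl d) := isPlot_opens_iff.1 hp.1
    have hp2 : ContDiff ℝ ∞ fun x => ((p x).1.2 : Eucl m) := isPlot_opens_iff.1 hp.2
    rw [isOpen_iff_mem_nhds]
    rintro x ⟨hx, hxL⟩
    have hO' : IsOpen ((fun x => ((p x).1.1 : Eucl d)) ⁻¹' O) := hO.preimage hp1.continuous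
    have := huniq n _ (fun x => ((p x).1.2 : Eucl m)) (fun x => L ((p x).1.1 : Eucl d)) hO'
      hp2.contDiffOn (hL.comp hp1.contDiffOn fun _ h => h)
      (fun y hy => ⟨(p y).1.2.2, hU _ hy, ((p y).2.symm.trans (hPL _ hy))⟩) x hx hxL
    filter_upwards [this, hO'.mem_nhds hx] with y hy hy'
    exact ⟨hy', hy⟩
  · rw [isOpen_dTopology_opens_iff]
    convert hO using 1
    ext r
    constructor
    · rintro ⟨r, hr, rfl⟩
      exact hr
    · exact fun h => ⟨⟨r, hW r h⟩, h, rfl⟩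
  · exact fun n p hp => hp.1
  · intro n p hp
    refine ⟨hp, ?_⟩
    exact isPlot_opens_iff.2 (hL.comp_contDiff (isPlot_opens_iff.1 hp) fun x => (p x).2)

/-- A diffeological étale map on a domain stays one after a smooth change of coordinates. -/
theorem IsDiffEtale.comp_symm (hπ : IsDiffEtale π)
    (α : OpenPartialHomeomorph (Eucl m) (Eucl m)) (hα : ContDiffOn ℝ ∞ α α.source)
    (hα' : ContDiffOn ℝ ∞ α.symm α.target) (hU : α.source ⊆ U) :
    IsDiffEtale fun t : (⟨α.target, α.open_target⟩ : Opens (Eucl m)) =>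
      π ⟨α.symm t, hU (α.map_target t.2)⟩ := by
  refine isDiffEtale_of_lifts (dSmooth_comp_contDiffOn hπ.1 hα' _) ?_ ?_
  · intro d W P hP r t hrt
    obtain ⟨O, L, hO, hr, hLr, hL, hlift⟩ := hπ.hasLocalLifts d W P hP r _ hrt
    have hr' : L r ∈ α.source := by rw [hLr]; exact α.map_target t.2
    -- Lifts along `π` may leave the domain of `α`, so `O` is shrunk by continuity.
    refine ⟨O ∩ L ⁻¹' α.source, α ∘ L, hL.continuousOn.isOpen_inter_preimage hO α.open_source,
      ⟨hr, hr'⟩, ?_, ?_, ?_⟩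
    · change α (L r) = t
      rw [hLr]
      exact α.right_inv t.2
    · exact hα.comp (hL.mono Set.inter_subset_left) fun x hx => hx.2
    · intro x hx
      obtain ⟨hW, hU', h⟩ := hlift x hx.1
      refine ⟨hW, α.map_source hx.2, h.trans (congrArg π (Subtype.ext ?_))⟩
      exact (α.left_inv hx.2).symm
  · intro d O L L' hO hL hL' hE r hr heq
    choose h h' hE using hE
    have := hπ.hasUniqueLocalLifts d O (α.symm ∘ L) (α.symm ∘ L') hO
      (hα'.comp hL h) (hα'.comp hL' h')
      (fun x hx => ⟨hU (α.map_target (h x hx)), hU (α.map_target (h' x hx)), hE x hx⟩) r hr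
      (congrArg α.symm heq)
    filter_upwards [this, hO.mem_nhds hr] with x hx hxO
    exact α.symm.injOn (h x hxO) (h' x hxO) hx

end

end EtaleDiffeology

namespace EtaleDiffeology

open Diffeology TopologicalSpace

/-! ### Internal tangent spaces of étale manifolds -/

section

variable {M : Type*} [DiffeologicalSpace M] {m : ℕ} {U : Opens (Eucl m)} {π : U → M}

/-- The parametrization `r ↦ π (u + r)`, as a plot centered at `x = π u`. -/
abbrev chartPlot (hπ : DSmooth π) (u : U) {x : M} (hx : π u = x) : CenteredPlot M x where
  dim := m
  dom := ⟨(fun r => u.1 + r) ⁻¹' U, U.isOpen.preimage (by fun_prop)⟩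
  zero_mem := by simp
  toFun := fun r => π ⟨u.1 + r, r.2⟩
  smooth := dSmooth_comp_contDiffOn (L := fun r => u.1 + r) hπ (by fun_prop) fun r => r.2
  map_zero := by
    rw [← hx]
    exact congrArg π (Subtype.ext (add_zero _))

theorem exists_isGermHom_chartPlot (hπ : IsDiffEtale π) (u : U) {x : M} (hx : π u = x)
    (P : CenteredPlot M x) : ∃ F, IsGermHom P (chartPlot hπ.1 u hx) F := by
  obtain ⟨O, L, hO, h0, hL0, hL, hlift⟩ := hπ.hasLocalLifts P.dim P.dom P.toFun P.smooth
    ⟨0, P.zero_mem⟩ u (P.map_zero.trans hx.symm)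
  have hL0' : L 0 = u := hL0
  refine ⟨fun r => L r - u.1, sub_eq_zero.2 hL0', ⟨O, hO⟩, h0, hL.sub contDiffOn_const,
    fun r hr => ?_⟩
  obtain ⟨hW, hU, h⟩ := hlift r hr
  have : u.1 + (L r - u.1) = L r := by abel
  refine ⟨hW, ?_, h.trans (congrArg π (Subtype.ext this.symm))⟩
  change u.1 + (L r - u.1) ∈ U
  rwa [this]

/-- With `exists_isGermHom_chartPlot`, this makes `chartPlot` a terminal object among germs. -/
theorem IsGermHom.eventuallyEq (hπ : IsDiffEtale π) {u : U} {x : M} {hx : π u = x}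
    {P : CenteredPlot M x} {F G : Eucl P.dim → Eucl (chartPlot hπ.1 u hx).dim}
    (hF : IsGermHom P (chartPlot hπ.1 u hx) F) (hG : IsGermHom P (chartPlot hπ.1 u hx) G) :
    F =ᶠ[𝓝 0] G := by
  obtain ⟨hF0, W, h0, hFs, hF⟩ := hF
  obtain ⟨hG0, W', h0', hGs, hG⟩ := hG
  have := hπ.hasUniqueLocalLifts P.dim (W ∩ W') (fun r => u.1 + (F r : Eucl m))
    (fun r => u.1 + (G r : Eucl m))
    (W.isOpen.inter W'.isOpen) (contDiffOn_const.add (hFs.mono Set.inter_subset_left))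
    (contDiffOn_const.add (hGs.mono Set.inter_subset_right)) (fun r hr => by
      obtain ⟨h1, h2, h3⟩ := hF r hr.1
      obtain ⟨h4, h5, h6⟩ := hG r hr.2
      exact ⟨h2, h5, h3.symm.trans h6⟩) 0 ⟨h0, h0'⟩ (congrArg (u.1 + ·) (hF0.trans hG0.symm))
  filter_upwards [this] with r hr
  exact add_left_cancel hr

theorem IsGermHom.refl {X : Type*} [DiffeologicalSpace X] {x : X} (P : CenteredPlot X x) :
    IsGermHom P P id :=
  ⟨rfl, P.dom, P.zero_mem, contDiffOn_id, fun _ hr => ⟨hr, hr, rfl⟩⟩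

theorem IsGermHom.differentiableAt {X : Type*} [DiffeologicalSpace X] {x : X}
    {P Q : CenteredPlot X x} {F : Eucl P.dim → Eucl Q.dim} (hF : IsGermHom P Q F) :
    DifferentiableAt ℝ F 0 := by
  obtain ⟨-, W, h0, hs, -⟩ := hF
  exact (hs.contDiffAt (W.isOpen.mem_nhds h0)).differentiableAt (by simp)

theorem IsGermHom.comp {X : Type*} [DiffeologicalSpace X] {x : X} {P Q R : CenteredPlot X x}
    {G : Eucl Q.dim → Eucl R.dim} {F : Eucl P.dim → Eucl Q.dim} (hG : IsGermHom Q R G)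
    (hF : IsGermHom P Q F) : IsGermHom P R (G ∘ F) := by
  obtain ⟨hF0, W, h0, hFs, hF⟩ := hF
  obtain ⟨hG0, W', h0', hGs, hG⟩ := hG
  refine ⟨by simp [hF0, hG0], ⟨W ∩ F ⁻¹' W',
    hFs.continuousOn.isOpen_inter_preimage W.isOpen W'.isOpen⟩, ⟨h0, ?_⟩,
    hGs.comp (hFs.mono Set.inter_subset_left) fun r hr => hr.2, fun r hr => ?_⟩
  · simpa [hF0] using h0'
  · obtain ⟨h1, h2, h3⟩ := hF r hr.1
    obtain ⟨h4, h5, h6⟩ := hG _ hr.2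
    exact ⟨h1, h5, h3.trans h6⟩

/-- The differential `ℝᵐ → T_x M` of the parametrization `π` at `u`. -/
noncomputable def chartDiff (hπ : DSmooth π) (u : U) {x : M} (hx : π u = x) :
    Eucl m →ₗ[ℝ] InternalTangentSpace M x :=
  plotDiff (chartPlot hπ u hx)

theorem chartDiff_fderiv (hπ : DSmooth π) (u : U) {x : M} (hx : π u = x) {P : CenteredPlot M x}
    {F : Eucl P.dim → Eucl m} (hF : IsGermHom P (chartPlot hπ u hx) F) (v : Eucl P.dim) :
    chartDiff hπ u hx (fderiv ℝ F 0 v) = plotDiff P v :=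
  plotDiff_fderiv hF v

theorem tangentMap_chartDiff {N : Type*} [DiffeologicalSpace N] {f : M → N} (hf : DSmooth f)
    (hπ : DSmooth π) (u : U) {x : M} (hx : π u = x) (v : Eucl m) :
    tangentMap hf x (chartDiff hπ u hx v) = chartDiff (hf.comp hπ) u (congrArg f hx) v :=
  tangentMap_plotDiff hf (chartPlot hπ u hx) v

theorem chartDiff_surjective (hπ : IsDiffEtale π) (u : U) {x : M} (hx : π u = x) :
    Function.Surjective (chartDiff hπ.1 u hx) := by
  -- Surjectivity is restated as vanishing of the quotient map by the range, which can be checked on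
  -- the generators `plotDiff P v`.
  rw [← LinearMap.range_eq_top, ← Submodule.ker_mkQ (LinearMap.range _), LinearMap.ker_eq_top]
  refine tangent_hom_ext fun P v => ?_
  obtain ⟨F, hF⟩ := exists_isGermHom_chartPlot hπ u hx P
  rw [← plotDiff_fderiv hF v]
  exact (Submodule.Quotient.mk_eq_zero _).2 ⟨_, rfl⟩

/-- The derivatives at `0` of the morphisms `F P` into the chart plot form a cocone, by uniqueness
of these germs. The induced map out of the colimit is a left inverse of `chartDiff`. -/
theorem chartDiff_injective (hπ : IsDiffEtale π) (u : U) {x : M} (hx : π u = x) :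
    Function.Injective (chartDiff hπ.1 u hx) := by
  choose F hF using exists_isGermHom_chartPlot hπ u hx
  have hc : ∀ (Q P : CenteredPlot M x) (G : Eucl Q.dim → Eucl P.dim), IsGermHom Q P G →
      ∀ v, (fderiv ℝ (F P) 0).toLinearMap (fderiv ℝ G 0 v) = (fderiv ℝ (F Q) 0).toLinearMap v := by
    intro Q P G hG v
    have h1 := ((hF Q).eventuallyEq hπ ((hF P).comp hG)).fderiv_eq (𝕜 := ℝ)
    have hFP : DifferentiableAt ℝ (F P) (G 0) := by
      rw [hG.1]; exact (hF P).differentiableAt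
    rw [fderiv_comp 0 hFP hG.differentiableAt, hG.1] at h1
    exact (DFunLike.congr_fun h1 v).symm
  have hid : ∀ v, (fderiv ℝ (F (chartPlot hπ.1 u hx)) 0).toLinearMap v = v := by
    intro v
    have h1 := ((hF (chartPlot hπ.1 u hx)).eventuallyEq hπ (.refl _)).fderiv_eq (𝕜 := ℝ)
    rw [fderiv_id] at h1
    exact DFunLike.congr_fun h1 v
  intro v w hvw
  have := congrArg (tangentDesc (fun P => (fderiv ℝ (F P) 0).toLinearMap) hc) hvw
  unfold chartDiff at this
  rwa [tangentDesc_plotDiff, tangentDesc_plotDiff, hid, hid] at this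

theorem IsLiftOn.isGermHom {n : ℕ} {V : Opens (Eucl n)} {ψ : V → M} (hπ : DSmooth π)
    (hψ : DSmooth ψ) {O : Set (Eucl m)} (hO : IsOpen O) {F : Eucl m → Eucl n}
    (hF : IsLiftOn ψ π O F) {u : U} (hu : u.1 ∈ O) {v : V} (hv : F u = v) {x : M} (hx : π u = x)
    (hx' : ψ v = x) :
    IsGermHom (chartPlot hπ u hx) (chartPlot hψ v hx')
      (fun r : Eucl m => F (u.1 + r) - v.1) := by
  have key : ∀ r : Eucl m, v.1 + (F (u.1 + r) - v.1) = F (u.1 + r) := fun r => by abel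
  refine ⟨?_, ⟨(fun r : Eucl m => u.1 + r) ⁻¹' O, hO.preimage (by fun_prop)⟩, ?_,
    (hF.1.comp (f := fun r : Eucl m => u.1 + r) (by fun_prop) fun r hr => hr).sub
      contDiffOn_const, ?_⟩
  · exact sub_eq_zero.2 ((congrArg F (add_zero u.1)).trans hv)
  · have h0 : u.1 + (0 : Eucl m) ∈ O := by rwa [add_zero]
    exact h0
  · intro (r : Eucl m) hr
    obtain ⟨h1, h2, h3⟩ := hF.2 _ hr
    have h4 : v.1 + (F (u.1 + r) - v.1) ∈ V := by rwa [key]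
    exact ⟨h1, h4, h3.trans (congrArg ψ (Subtype.ext (key r).symm))⟩

theorem IsLiftOn.chartDiff_fderiv {n : ℕ} {V : Opens (Eucl n)} {ψ : V → M} (hπ : DSmooth π)
    (hψ : DSmooth ψ) {O : Set (Eucl m)} (hO : IsOpen O) {F : Eucl m → Eucl n}
    (hF : IsLiftOn ψ π O F) {u : U} (hu : u.1 ∈ O) {v : V} (hv : F u = v) {x : M} (hx : π u = x)
    (hx' : ψ v = x) (w : Eucl m) :
    chartDiff hψ v hx' (fderiv ℝ F u w) = chartDiff hπ u hx w := by
  have hd : fderiv ℝ (fun r : Eucl m => F (u.1 + r) - v.1) 0 = fderiv ℝ F u := by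
    rw [fderiv_sub_const, fderiv_comp_add_left, add_zero]
  rw [← hd]
  exact EtaleDiffeology.chartDiff_fderiv hψ v hx' (hF.isGermHom hπ hψ hO hu hv hx hx') w

/-- In étale charts, the internal rank of a smooth map is the rank of its local representative. -/
theorem finrank_range_fderiv_eq {N : Type*} [DiffeologicalSpace N] {n : ℕ} {V : Opens (Eucl n)}
    {ψ : V → N} (hπ : IsDiffEtale π) (hψ : IsDiffEtale ψ) {f : M → N} (hf : DSmooth f)
    {O : Set (Eucl m)} (hO : IsOpen O) {F : Eucl m → Eucl n} (hF : IsLiftOn ψ (f ∘ π) O F)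
    {u : U} (hu : u.1 ∈ O) :
    Module.finrank ℝ (fderiv ℝ F u).range = Module.finrank ℝ (tangentMap hf (π u)).range := by
  obtain ⟨hFu, hfu⟩ : ∃ h : F u ∈ V, f (π u) = ψ ⟨F u, h⟩ := (hF.2 u hu).2
  -- In this square the left chart differential is onto and the right one injective, so the two
  -- horizontal maps have the same rank.
  have hcomp : tangentMap hf (π u) ∘ₗ chartDiff hπ.1 u rfl =
      chartDiff hψ.1 ⟨F u, hFu⟩ hfu.symm ∘ₗ (fderiv ℝ F u).toLinearMap := by
    refine LinearMap.ext fun v => (tangentMap_chartDiff hf hπ.1 u rfl v).trans ?_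
    exact (hF.chartDiff_fderiv (hf.comp hπ.1) hψ.1 hO hu rfl rfl hfu.symm v).symm
  have hrange : (tangentMap hf (π u)).range =
      (fderiv ℝ F u).range.map (chartDiff hψ.1 ⟨F u, hFu⟩ hfu.symm) := by
    have h1 := congrArg LinearMap.range hcomp
    rw [LinearMap.range_comp, LinearMap.range_comp,
      LinearMap.range_eq_top.2 (chartDiff_surjective hπ u rfl), Submodule.map_top] at h1
    exact h1
  rw [hrange]
  exact (Submodule.equivMapOfInjective _ (chartDiff_injective hψ _ hfu.symm) _).finrank_eq

end

end EtaleDiffeology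

namespace EtaleDiffeology

open TopologicalSpace

/-! ### The constant rank theorem -/

/-- A homeomorphism between open sets which is smooth in both directions. -/
def IsSmoothCoord {E F : Type*} [NormedAddCommGroup E] [NormedSpace ℝ E] [NormedAddCommGroup F]
    [NormedSpace ℝ F] (α : OpenPartialHomeomorph E F) : Prop :=
  ContDiffOn ℝ ∞ α α.source ∧ ContDiffOn ℝ ∞ α.symm α.target

section

variable {E E' F S Y Z : Type*} [NormedAddCommGroup E] [NormedSpace ℝ E]
  [NormedAddCommGroup F] [NormedSpace ℝ F] [NormedAddCommGroup E'] [NormedSpace ℝ E']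
  [NormedAddCommGroup S] [NormedSpace ℝ S]
  [NormedAddCommGroup Y] [NormedSpace ℝ Y] [NormedAddCommGroup Z] [NormedSpace ℝ Z]

theorem IsSmoothCoord.trans {α : OpenPartialHomeomorph E F} {β : OpenPartialHomeomorph F E'}
    (hα : IsSmoothCoord α) (hβ : IsSmoothCoord β) : IsSmoothCoord (α.trans β) := by
  constructor
  · rw [α.coe_trans, α.trans_source]
    exact hβ.1.comp (hα.1.mono Set.inter_subset_left) fun x hx => hx.2
  · rw [α.coe_trans_symm, α.trans_target]
    exact hα.2.comp (hβ.2.mono Set.inter_subset_left) fun x hx => hx.2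

theorem IsSmoothCoord.restr {α : OpenPartialHomeomorph E F} (hα : IsSmoothCoord α) {s : Set E}
    (hs : IsOpen s) : IsSmoothCoord (α.restrOpen s hs) := by
  constructor
  · rw [α.restrOpen_source]
    exact hα.1.mono Set.inter_subset_left
  · exact hα.2.mono fun x hx => hx.1

theorem _root_.ContinuousLinearEquiv.isSmoothCoord (a : E ≃L[ℝ] F) :
    IsSmoothCoord a.toHomeomorph.toOpenPartialHomeomorph :=
  ⟨a.contDiff.contDiffOn, a.symm.contDiff.contDiffOn⟩

/-- The inverse function theorem on an open set. -/
theorem exists_isSmoothCoord [CompleteSpace E] {G : E → F} {O : Set E} (hO : IsOpen O)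
    (hG : ContDiffOn ℝ ∞ G O) {x : E} (hx : x ∈ O) {G' : E ≃L[ℝ] F}
    (hG' : HasFDerivAt G (G' : E →L[ℝ] F) x) :
    ∃ α : OpenPartialHomeomorph E F, IsSmoothCoord α ∧ x ∈ α.source ∧ α.source ⊆ O ∧
      ∀ y, α y = G y := by
  have hGx := hG.contDiffAt (hO.mem_nhds hx)
  let e := hGx.toOpenPartialHomeomorph G hG' (by simp)
  -- Invertibility of the derivative is an open condition. Restricting to where it holds makes the
  -- inverse smooth on the whole target, not only at the image of `x`.
  have hinv : ∀ᶠ y in 𝓝 x, fderiv ℝ G y ∈ Set.range ((↑) : (E ≃L[ℝ] F) → E →L[ℝ] F) := by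
    have hc : ContinuousAt (fderiv ℝ G) x := (hGx.fderiv_right (m := 0) (by simp)).continuousAt
    refine hc ?_
    rw [hG'.fderiv]
    exact ContinuousLinearEquiv.nhds G'
  obtain ⟨T, hT, hTo, hxT⟩ := eventually_nhds_iff.1 hinv
  refine ⟨e.restrOpen (O ∩ T) (hO.inter hTo), ⟨?_, ?_⟩,
    ⟨hGx.mem_toOpenPartialHomeomorph_source hG' (by simp), hx, hxT⟩, fun y hy => hy.2.1,
    fun y => rfl⟩
  · exact hG.mono fun y hy => hy.2.1
  · intro z hz
    have hy := (e.restrOpen (O ∩ T) (hO.inter hTo)).map_target hz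
    obtain ⟨G'', hG''⟩ := hT _ hy.2.2
    have hGy := hG.contDiffAt (hO.mem_nhds hy.2.1)
    refine ((e.restrOpen (O ∩ T) (hO.inter hTo)).contDiffAt_symm (f₀' := G'') hz ?_
      hGy).contDiffWithinAt
    rw [hG'']
    exact (hGy.differentiableAt (by simp)).hasFDerivAt

/-- The projection of the range of `T` to `S` is onto, hence injective by equality of dimensions,
and `T (0, y)` projects to `0`. -/
theorem apply_inr_eq_zero_of_finrank_range [FiniteDimensional ℝ S] [FiniteDimensional ℝ Y]
    {T : S × Y →ₗ[ℝ] S × Z} (hfst : ∀ v, (T v).1 = v.1)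
    (hT : Module.finrank ℝ T.range = Module.finrank ℝ S) (y : Y) : T (0, y) = 0 := by
  let q : T.range →ₗ[ℝ] S := LinearMap.fst ℝ S Z ∘ₗ T.range.subtype
  have hq : Function.Surjective q := fun s => ⟨⟨T (s, 0), _, rfl⟩, hfst _⟩
  have hq' : Function.Injective q :=
    (LinearMap.injective_iff_surjective_of_finrank_eq_finrank hT).2 hq
  have := hq' (a₁ := ⟨T (0, y), _, rfl⟩) (a₂ := 0) (by rw [map_zero]; exact hfst _)
  exact congrArg Subtype.val this

theorem eq_of_fderiv_inr_eq_zero {H : S × Y → E} {s₀ : S} {y₀ : Y} {ε : ℝ}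
    (hH : ∀ p ∈ Metric.ball s₀ ε ×ˢ Metric.ball y₀ ε, DifferentiableAt ℝ H p)
    (h0 : ∀ p ∈ Metric.ball s₀ ε ×ˢ Metric.ball y₀ ε, ∀ y, fderiv ℝ H p (0, y) = 0)
    {s : S} (hs : s ∈ Metric.ball s₀ ε) {y : Y} (hy : y ∈ Metric.ball y₀ ε) :
    H (s, y) = H (s, y₀) := by
  have hε : 0 < ε := Metric.pos_of_mem_ball hs
  have hd : ∀ z ∈ Metric.ball y₀ ε, HasFDerivAt (fun z => H (s, z)) (0 : Y →L[ℝ] E) z := by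
    intro z hz
    have h1 := (hH (s, z) ⟨hs, hz⟩).hasFDerivAt.comp z (hasFDerivAt_prodMk_right s z)
    refine h1.congr_fderiv (ContinuousLinearMap.ext fun v => ?_)
    simp [h0 (s, z) ⟨hs, hz⟩ v]
  refine (convex_ball y₀ ε).is_const_of_fderivWithin_eq_zero (𝕜 := ℝ) (f := fun z => H (s, z))
    (fun z hz => (hd z hz).differentiableAt.differentiableWithinAt) (fun z hz => ?_) hy
    (Metric.mem_ball_self hε)
  rw [fderivWithin_of_isOpen Metric.isOpen_ball hz, (hd z hz).fderiv]

/-- The shear `(s, z) ↦ (s, z - g s)` over an open set. -/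
def shear (g : S → Z) {B : Set S} (hB : IsOpen B) (hg : ContinuousOn g B) :
    OpenPartialHomeomorph (S × Z) (S × Z) where
  toFun p := (p.1, p.2 - g p.1)
  invFun p := (p.1, p.2 + g p.1)
  source := B ×ˢ Set.univ
  target := B ×ˢ Set.univ
  map_source' _ hp := ⟨hp.1, trivial⟩
  map_target' _ hp := ⟨hp.1, trivial⟩
  left_inv' p _ := by simp
  right_inv' p _ := by simp
  open_source := hB.prod isOpen_univ
  open_target := hB.prod isOpen_univ
  continuousOn_toFun := continuousOn_fst.prodMk
    (continuousOn_snd.sub (hg.comp continuousOn_fst fun _ hp => hp.1))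
  continuousOn_invFun := continuousOn_fst.prodMk
    (continuousOn_snd.add (hg.comp continuousOn_fst fun _ hp => hp.1))

theorem isSmoothCoord_shear {g : S → Z} {B : Set S} (hB : IsOpen B) (hg : ContDiffOn ℝ ∞ g B) :
    IsSmoothCoord (shear g hB hg.continuousOn) :=
  ⟨contDiffOn_fst.prodMk (contDiffOn_snd.sub (hg.comp contDiffOn_fst fun _ hp => hp.1)),
    contDiffOn_fst.prodMk (contDiffOn_snd.add (hg.comp contDiffOn_fst fun _ hp => hp.1))⟩

/-- The constant rank theorem, for a map whose derivative at the base point is already in normal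
form. -/
theorem exists_constantRank_coord_prod [FiniteDimensional ℝ S] [FiniteDimensional ℝ Y]
    {f : S × Y → S × Z} {O : Set (S × Y)} (hO : IsOpen O) (hf : ContDiffOn ℝ ∞ f O)
    (hrank : ∀ p ∈ O, Module.finrank ℝ (fderiv ℝ f p).range = Module.finrank ℝ S)
    {p₀ : S × Y} (hp₀ : p₀ ∈ O) (hf₀ : ∀ p, fderiv ℝ f p₀ p = (p.1, 0)) :
    ∃ (α : OpenPartialHomeomorph (S × Y) (S × Y)) (β : OpenPartialHomeomorph (S × Z) (S × Z)),
      IsSmoothCoord α ∧ IsSmoothCoord β ∧ p₀ ∈ α.source ∧ α.source ⊆ O ∧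
      Set.MapsTo f α.source β.source ∧ ∀ p ∈ α.source, β (f p) = ((α p).1, 0) := by
  have hdf : ∀ p ∈ O, DifferentiableAt ℝ f p := fun p hp =>
    (hf.contDiffAt (hO.mem_nhds hp)).differentiableAt (by simp)
  -- The derivative of `G` at `p₀` is the identity, so `G` is a local coordinate; in it, `f` becomes
  -- a map `H` preserving the first component.
  let G : S × Y → S × Y := fun p => ((f p).1, p.2)
  have hG : ContDiffOn ℝ ∞ G O := hf.fst.prodMk contDiffOn_snd
  have hG₀ : HasFDerivAt G ((ContinuousLinearEquiv.refl ℝ (S × Y) : _ →L[ℝ] _)) p₀ := by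
    have h1 := ((hdf p₀ hp₀).hasFDerivAt.fst).prodMk (hasFDerivAt_snd (𝕜 := ℝ) (p := p₀))
    refine h1.congr_fderiv ?_
    refine ContinuousLinearMap.ext fun v => ?_
    simp [hf₀]
  obtain ⟨γ, hγ, hpγ, hγO, hγG⟩ := exists_isSmoothCoord hO hG hp₀ hG₀
  obtain ⟨ε, hε, hball⟩ := Metric.isOpen_iff.1 γ.open_target (γ p₀) (γ.map_source hpγ)
  rw [← ball_prod_same] at hball
  let B := Metric.ball (γ p₀).1 ε
  let B' := Metric.ball (γ p₀).2 ε
  let H : S × Y → S × Z := f ∘ γ.symm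
  have hHs : ContDiffOn ℝ ∞ H γ.target := hf.comp hγ.2 fun q hq => hγO (γ.map_target hq)
  have hH1 : ∀ q ∈ γ.target, (H q).1 = q.1 := fun q hq => by
    have h1 := congrArg Prod.fst (γ.right_inv hq)
    rwa [hγG] at h1
  have hHd : ∀ q ∈ γ.target, DifferentiableAt ℝ H q := fun q hq =>
    (hHs.contDiffAt (γ.open_target.mem_nhds hq)).differentiableAt (by simp)
  have hH0 : ∀ q ∈ γ.target, ∀ y, fderiv ℝ H q (0, y) = 0 := by
    intro q hq y
    have hqO := hγO (γ.map_target hq)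
    refine apply_inr_eq_zero_of_finrank_range (T := (fderiv ℝ H q).toLinearMap) (fun v => ?_) ?_ y
    · have h1 : (fun q => (H q).1) =ᶠ[𝓝 q] Prod.fst :=
        Filter.eventuallyEq_of_mem (γ.open_target.mem_nhds hq) hH1
      have h2 := ((hHd q hq).hasFDerivAt.fst).unique
        ((hasFDerivAt_fst (𝕜 := ℝ) (p := q)).congr_of_eventuallyEq h1)
      exact DFunLike.congr_fun h2 v
    · have hγd : DifferentiableAt ℝ γ (γ.symm q) :=
        (hγ.1.contDiffAt (γ.open_source.mem_nhds (γ.map_target hq))).differentiableAt (by simp)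
      have hγd' : DifferentiableAt ℝ γ.symm q :=
        (hγ.2.contDiffAt (γ.open_target.mem_nhds hq)).differentiableAt (by simp)
      have h1 : fderiv ℝ H q = (fderiv ℝ f (γ.symm q)).comp (fderiv ℝ γ.symm q) :=
        fderiv_comp q (hdf _ hqO) hγd'
      have h2 : (fderiv ℝ γ.symm q).comp (fderiv ℝ γ (γ.symm q)) = .id ℝ (S × Y) := by
        have h3 : γ.symm ∘ γ =ᶠ[𝓝 (γ.symm q)] id :=
          Filter.eventuallyEq_of_mem (γ.open_source.mem_nhds (γ.map_target hq))
            fun p hp => γ.left_inv hp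
        rw [← fderiv_id, ← h3.fderiv_eq, fderiv_comp, γ.right_inv hq]
        · rwa [γ.right_inv hq]
        · exact hγd
      -- Precomposing with a surjective differential keeps the range, so `H` has the same constant
      -- rank as `f`. The rank then leaves no room for a `Y`-derivative.
      have h4 : Function.Surjective (fderiv ℝ γ.symm q) := fun v =>
        ⟨fderiv ℝ γ (γ.symm q) v, DFunLike.congr_fun h2 v⟩
      rw [h1, ← hrank _ hqO, ContinuousLinearMap.toLinearMap_comp,
        LinearMap.range_comp_of_range_eq_top _ (LinearMap.range_eq_top.2 h4)]
  have hconst : ∀ s ∈ B, ∀ y ∈ B', H (s, y) = H (s, (γ p₀).2) := fun s hs y hy =>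
    eq_of_fderiv_inr_eq_zero (fun p hp => hHd p (hball hp)) (fun p hp => hH0 p (hball hp)) hs hy
  -- On the box, `H (s, y) = (s, g s)`, and the shear by `g` straightens this graph.
  let g : S → Z := fun s => (H (s, (γ p₀).2)).2
  have hB : IsOpen B := Metric.isOpen_ball
  have hg : ContDiffOn ℝ ∞ g B :=
    (hHs.comp (f := fun s => (s, (γ p₀).2)) (by fun_prop)
      fun s hs => hball ⟨hs, Metric.mem_ball_self hε⟩).snd
  have hBB : IsOpen (γ.source ∩ γ ⁻¹' (B ×ˢ B')) :=
    γ.isOpen_inter_preimage (hB.prod Metric.isOpen_ball)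
  refine ⟨γ.restrOpen _ hBB, shear g hB hg.continuousOn, hγ.restr hBB, isSmoothCoord_shear hB hg,
    ⟨hpγ, hpγ, Metric.mem_ball_self hε, Metric.mem_ball_self hε⟩, fun p hp => hγO hp.1, ?_, ?_⟩
  · rintro p ⟨hp, -, hp1, hp2⟩
    refine ⟨?_, trivial⟩
    rw [hγG] at hp1
    exact hp1
  · rintro p ⟨hp, -, hp1, hp2⟩
    have h1 : H (γ p) = f p := congrArg f (γ.left_inv hp)
    have h2 := hconst _ hp1 _ hp2
    have h3 : (γ p).1 = (f p).1 := by rw [hγG]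
    change ((f p).1, (f p).2 - g (f p).1) = ((γ p).1, 0)
    rw [← h3]
    refine Prod.ext rfl (sub_eq_zero.2 ?_)
    rw [← h1]
    exact congrArg Prod.snd h2

/-- Linear normal form of a linear map of rank `k`. -/
theorem exists_linear_rank_coord {m n k : ℕ} (A : Eucl m →ₗ[ℝ] Eucl n)
    (hA : Module.finrank ℝ A.range = k) : ∃ (_ : k ≤ m) (_ : k ≤ n)
      (a : Eucl m ≃L[ℝ] Eucl k × Eucl (m - k)) (b : Eucl n ≃L[ℝ] Eucl k × Eucl (n - k)),
      ∀ v, b (A v) = ((a v).1, 0) := by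
  have hkn : k ≤ n := by
    simpa [hA] using A.range.finrank_le
  have hdim := A.finrank_range_add_finrank_ker
  rw [hA, finrank_euclideanSpace_fin] at hdim
  have hkm : k ≤ m := by omega
  obtain ⟨C, hC⟩ := Submodule.exists_isCompl A.ker
  obtain ⟨D, hD⟩ := Submodule.exists_isCompl A.range
  have hDdim := Submodule.finrank_add_eq_of_isCompl hD
  rw [hA, finrank_euclideanSpace_fin] at hDdim
  let r : A.range ≃ₗ[ℝ] Eucl k := LinearEquiv.ofFinrankEq _ _ (by simp [hA])
  let d : D ≃ₗ[ℝ] Eucl (n - k) := LinearEquiv.ofFinrankEq _ _ (by simp; omega)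
  let c : A.ker ≃ₗ[ℝ] Eucl (m - k) := LinearEquiv.ofFinrankEq _ _ (by simp; omega)
  let b : Eucl n ≃ₗ[ℝ] Eucl k × Eucl (n - k) :=
    (Submodule.prodEquivOfIsCompl _ _ hD).symm ≪≫ₗ r.prodCongr d
  -- The same identification `r` of the range with `ℝᵏ` enters both `a'` and `b`, which is why their
  -- first components match.
  let a' : Eucl m →ₗ[ℝ] Eucl k × Eucl (m - k) :=
    (r.toLinearMap ∘ₗ A.rangeRestrict).prod (c.toLinearMap ∘ₗ A.ker.projectionOnto C hC)
  have ha' : Function.Injective a' := by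
    rw [← LinearMap.ker_eq_bot, LinearMap.ker_eq_bot']
    intro v hv
    have h1 : r (A.rangeRestrict v) = 0 := congrArg Prod.fst hv
    have h2 : c (A.ker.projectionOnto C hC v) = 0 := congrArg Prod.snd hv
    rw [LinearEquiv.map_eq_zero_iff] at h1 h2
    have h3 : v ∈ A.ker := congrArg Subtype.val h1
    have h4 := Submodule.projectionOnto_apply_left hC ⟨v, h3⟩
    rw [h2] at h4
    exact (congrArg Subtype.val h4).symm
  let a : Eucl m ≃ₗ[ℝ] Eucl k × Eucl (m - k) :=
    LinearEquiv.ofInjectiveOfFinrankEq a' ha' (by simp; omega)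
  refine ⟨hkm, hkn, a.toContinuousLinearEquiv, b.toContinuousLinearEquiv, fun v => ?_⟩
  have h1 : (Submodule.prodEquivOfIsCompl _ _ hD).symm (A v) = (A.rangeRestrict v, 0) := by
    rw [LinearEquiv.symm_apply_eq]
    simp
  change (r.prodCongr d) ((Submodule.prodEquivOfIsCompl _ _ hD).symm (A v)) = _
  rw [h1]
  refine Prod.ext ?_ ?_
  · rfl
  · exact map_zero d

/-- The splitting `ℝᵐ = ℝᵏ × ℝᵐ⁻ᵏ` into the first `k` and the last `m - k` coordinates. -/
noncomputable def splitCoord {m k : ℕ} (h : k ≤ m) : Eucl m ≃L[ℝ] Eucl k × Eucl (m - k) :=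
  LinearEquiv.toContinuousLinearEquiv
    { toFun := fun x => (WithLp.toLp 2 fun i => x ⟨i, by omega⟩,
        WithLp.toLp 2 fun i => x ⟨k + i, by omega⟩)
      invFun := fun p => WithLp.toLp 2 fun i =>
        if hi : i.1 < k then p.1 ⟨i, hi⟩ else p.2 ⟨i - k, by omega⟩
      map_add' := fun x y => rfl
      map_smul' := fun c x => rfl
      left_inv := fun x => by
        ext i
        by_cases hi : i.1 < k
        · simp [hi]
        · simp [hi, Nat.add_sub_cancel' (not_lt.1 hi)]
      right_inv := fun p => by
        refine Prod.ext ?_ ?_ <;> ext i <;> simp }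

theorem splitCoord_symm_fst {m n k : ℕ} (hm : k ≤ m) (hn : k ≤ n) (x : Eucl m) :
    (splitCoord hn).symm ((splitCoord hm x).1, 0) = rankNormalForm m n k hm x := by
  ext i
  by_cases hi : i.1 < k
  · simp [splitCoord, rankNormalForm, hi]
    rfl
  · simp [splitCoord, rankNormalForm, hi]

/-- The constant rank theorem. -/
theorem exists_constantRank_coord {m n k : ℕ} {f : Eucl m → Eucl n} {O : Set (Eucl m)}
    (hO : IsOpen O) (hf : ContDiffOn ℝ ∞ f O)
    (hrank : ∀ u ∈ O, Module.finrank ℝ (fderiv ℝ f u).range = k) {u₀ : Eucl m} (hu₀ : u₀ ∈ O) :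
    ∃ (hkm : k ≤ m) (_ : k ≤ n) (α : OpenPartialHomeomorph (Eucl m) (Eucl m))
      (β : OpenPartialHomeomorph (Eucl n) (Eucl n)),
      IsSmoothCoord α ∧ IsSmoothCoord β ∧ u₀ ∈ α.source ∧ α.source ⊆ O ∧
      Set.MapsTo f α.source β.source ∧
      ∀ u ∈ α.source, β (f u) = rankNormalForm m n k hkm (α u) := by
  -- Linear coordinates put the derivative at `u₀` in normal form; the bounds on `k` already come
  -- from this one linear map.
  obtain ⟨hkm, hkn, a, b, hab⟩ := exists_linear_rank_coord (fderiv ℝ f u₀).toLinearMap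
    (hrank u₀ hu₀)
  have hO' : IsOpen (a.symm ⁻¹' O) := hO.preimage a.symm.continuous
  have hfd : ∀ p ∈ a.symm ⁻¹' O, fderiv ℝ (b ∘ f ∘ a.symm) p =
      (b : Eucl n →L[ℝ] _).comp ((fderiv ℝ f (a.symm p)).comp (a.symm : _ →L[ℝ] Eucl m)) := by
    intro p hp
    have h1 : DifferentiableAt ℝ f (a.symm p) :=
      (hf.contDiffAt (hO.mem_nhds hp)).differentiableAt (by simp)
    exact (b.hasFDerivAt.comp p (h1.hasFDerivAt.comp p a.symm.hasFDerivAt)).fderiv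
  obtain ⟨α, β, hα, hβ, hu, hαO, hmaps, hαβ⟩ := exists_constantRank_coord_prod
    (f := b ∘ f ∘ a.symm) hO'
    (b.contDiff.comp_contDiffOn (hf.comp a.symm.contDiff.contDiffOn fun _ h => h))
    (fun p hp => by
      rw [hfd p hp, finrank_euclideanSpace_fin]
      have h1 : ((b : Eucl n →L[ℝ] _).comp ((fderiv ℝ f (a.symm p)).comp
          (a.symm : Eucl k × Eucl (m - k) →L[ℝ] Eucl m))).range =
          (fderiv ℝ f (a.symm p)).range.map b.toLinearEquiv.toLinearMap := by
        ext z
        simp only [LinearMap.mem_range, Submodule.mem_map]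
        constructor
        · rintro ⟨y, rfl⟩
          exact ⟨_, ⟨a.symm y, rfl⟩, rfl⟩
        · rintro ⟨_, ⟨y, rfl⟩, rfl⟩
          exact ⟨a y, by simp⟩
      rw [h1, LinearEquiv.finrank_map_eq, hrank _ hp])
    (p₀ := a u₀) (by simpa using hu₀)
    (fun p => by
      rw [hfd _ (by simpa using hu₀)]
      have h1 := hab (a.symm p)
      simpa using h1)
  refine ⟨hkm, hkn,
    (a.toHomeomorph.toOpenPartialHomeomorph.trans α).trans
      (splitCoord hkm).symm.toHomeomorph.toOpenPartialHomeomorph,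
    (b.toHomeomorph.toOpenPartialHomeomorph.trans β).trans
      (splitCoord hkn).symm.toHomeomorph.toOpenPartialHomeomorph,
    (a.isSmoothCoord.trans hα).trans (splitCoord hkm).symm.isSmoothCoord,
    (b.isSmoothCoord.trans hβ).trans (splitCoord hkn).symm.isSmoothCoord, ?_, ?_, ?_, ?_⟩
  · simpa using hu
  · intro u hu
    have h1 : a u ∈ α.source := by simpa using hu
    simpa using hαO h1
  · intro u hu
    have h1 : a u ∈ α.source := by simpa using hu
    simpa using hmaps h1
  · intro u hu
    have h1 : a u ∈ α.source := by simpa using hu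
    have h2 := hαβ _ h1
    rw [← splitCoord_symm_fst hkm hkn]
    simp at h2 ⊢
    exact h2

end

end EtaleDiffeology

/-! ### Proof of the rank theorem in étale charts -/

theorem theorem6p8 {M N : Type*} [DiffeologicalSpace M] [DiffeologicalSpace N] (m n k : ℕ)
    (hM : EtaleDiffeology.IsEtaleManifold m M) (hN : EtaleDiffeology.IsEtaleManifold n N)
    (f : M → N) (hf : Diffeology.DSmooth f)
    (hk : EtaleDiffeology.HasConstantInternalRank hf k) (x : M) :
    ∃ (hkm : k ≤ m) (_ : k ≤ n)
      (U : TopologicalSpace.Opens (EuclideanSpace ℝ (Fin m)))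
      (V : TopologicalSpace.Opens (EuclideanSpace ℝ (Fin n)))
      (φ : U → M) (ψ : V → N),
      EtaleDiffeology.IsDiffEtale φ ∧ EtaleDiffeology.IsDiffEtale ψ ∧
      x ∈ Set.range φ ∧ f x ∈ Set.range ψ ∧
      ∃ hF : ∀ r : U, EtaleDiffeology.rankNormalForm m n k hkm r ∈ V,
        ∀ r : U, f (φ r) = ψ ⟨EtaleDiffeology.rankNormalForm m n k hkm r, hF r⟩ := by
  obtain ⟨A, hA, hAM⟩ := hM
  obtain ⟨⟨U, φ⟩, hφA, u₀, hu₀⟩ := hAM x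
  have hφ : EtaleDiffeology.IsDiffEtale φ := hA _ hφA
  replace hu₀ : φ u₀ = x := hu₀
  obtain ⟨B, hB, hBN⟩ := hN
  obtain ⟨⟨V, ψ⟩, hψB, v₀, hv₀⟩ := hBN (f x)
  have hψ : EtaleDiffeology.IsDiffEtale ψ := hB _ hψB
  replace hv₀ : ψ v₀ = f x := hv₀
  obtain ⟨O, F, hO, huO, -, hF⟩ := hψ.hasLocalLifts m U (f ∘ φ) (hf.comp hφ.1) u₀ v₀
    ((congrArg f hu₀).trans hv₀.symm)
  have hrank : ∀ u ∈ O, Module.finrank ℝ (fderiv ℝ F u).range = k := by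
    intro u hu
    obtain ⟨hU, -⟩ := hF.2 u hu
    refine (EtaleDiffeology.finrank_range_fderiv_eq hφ hψ hf hO hF (u := ⟨u, hU⟩) hu).trans ?_
    exact Module.finrank_eq_of_rank_eq (hk _)
  obtain ⟨hkm, hkn, α, β, hα, hβ, huα, hαO, hmaps, hαβ⟩ :=
    EtaleDiffeology.exists_constantRank_coord hO hF.1 hrank huO
  have hαU : α.source ⊆ U := fun u hu => (hF.2 u (hαO hu)).1
  -- The source of `β` may exceed the domain of `ψ`; since `F` takes values in `V` on `O`,
  -- restricting to `V` loses nothing.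
  let β' := β.restrOpen V V.isOpen
  have hβ' : EtaleDiffeology.IsSmoothCoord β' := hβ.restr V.isOpen
  have hβ'V : β'.source ⊆ V := fun v hv => hv.2
  have hmaps' : Set.MapsTo F α.source β'.source := fun u hu =>
    ⟨hmaps hu, (hF.2 u (hαO hu)).2.1⟩
  have hnf : ∀ t ∈ α.target,
      β' (F (α.symm t)) = EtaleDiffeology.rankNormalForm m n k hkm t := fun t ht => by
    have h1 := hαβ _ (α.map_target ht)
    rwa [α.right_inv ht] at h1
  have hmem : ∀ t ∈ α.target, EtaleDiffeology.rankNormalForm m n k hkm t ∈ β'.target :=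
    fun t ht => hnf t ht ▸ β'.map_source (hmaps' (α.map_target ht))
  have hcomm : ∀ t (ht : t ∈ α.target), f (φ ⟨α.symm t, hαU (α.map_target ht)⟩) =
      ψ ⟨β'.symm (EtaleDiffeology.rankNormalForm m n k hkm t),
        hβ'V (β'.map_target (hmem t ht))⟩ := fun t ht => by
    obtain ⟨_, _, h⟩ := hF.2 _ (hαO (α.map_target ht))
    refine h.trans (congrArg ψ (Subtype.ext ?_))
    change F (α.symm t) = β'.symm _
    rw [← hnf t ht, β'.left_inv (hmaps' (α.map_target ht))]
  have hx : φ ⟨α.symm (α u₀), hαU (α.map_target (α.map_source huα))⟩ = x :=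
    (congrArg φ (Subtype.ext (α.left_inv huα))).trans hu₀
  refine ⟨hkm, hkn, ⟨α.target, α.open_target⟩, ⟨β'.target, β'.open_target⟩, _, _,
    hφ.comp_symm α hα.1 hα.2 hαU, hψ.comp_symm β' hβ'.1 hβ'.2 hβ'V,
    ⟨⟨α u₀, α.map_source huα⟩, hx⟩,
    ⟨⟨_, hmem _ (α.map_source huα)⟩, ?_⟩, fun r => hmem _ r.2, fun r => hcomm _ r.2⟩
  rw [← hx]
  exact (hcomm _ (α.map_source huα)).symm
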